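/- Let $p$ be a prime, let $\mathbb{F}$ be a field of characteristic $p$, and let $L$ be a restricted Lie algebra over $\mathbb{F}$, that is, a Lie algebra with a $p$-map $x\mapsto x^{[p]}$ such that $\mathrm{ad}(x^{[p]})=(\mathrm{ad}\,x)^p$, $(ax)^{[p]}=a^p x^{[p]}$ and $(x+y)^{[p]}=x^{[p]}+y^{[p]}+\sum_{i=1}^{p-1}s_i(x,y)$ for all $x,y\in L$, $a\in\mathbb{F}$, where $i\,s_i(x,y)$ is the coefficient of $T^{i-1}$ in $(\mathrm{ad}(x\otimes T+y\otimes 1))^{p-1}(x\otimes 1)\in L\otimes\mathbb{F}[T]$. Let $u(L)$ be the restricted enveloping algebra of $L$, that is, the quotient of the universal enveloping algebra $U(L)$ by the two-sided ideal generated by all $x^p-x^{[p]}$ with $x\in L$. A restricted subalgebra (restricted ideal) of $L$ is a Lie subalgebra (ideal) closed under the $p$-map. Assume that $L$ is locally finite-dimensional, that is, every restricted subalgebra of $L$ generated by a finite set is finite-dimensional. If $L$ has a restricted ideal $P$ such that $\dim_{\mathbb{F}} L/P<\infty$ and $P$ is $p$-nil, that is, for every $x\in P$ some iterate of the $p$-map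 sends $x$ to $0$, then $u(L)$ is semiperfect: with $\mathcal{J}$ the Jacobson radical of $u(L)$, the ring $u(L)/\mathcal{J}$ is Artinian and every idempotent of $u(L)/\mathcal{J}$ is the image of an idempotent of $u(L)$. -/

import Mathlib

universe u v

namespace RestrictedLie

/-- For `x y` in a Lie algebra, `adCoeff x y n j` is the coefficient of `T ^ j` in
`(ad (x ⊗ T + y ⊗ 1)) ^ n (x ⊗ 1)`, computed in the Lie algebra `L ⊗ F[T]`
(see `ad_pow_eq_sum` below for this identity). -/
def adCoeff {L : Type v} [LieRing L] (x y : L) : ℕ → ℕ → L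
  | 0, 0 => x
  | 0, _ + 1 => 0
  | n + 1, 0 => ⁅y, adCoeff x y n 0⁆
  | n + 1, j + 1 => ⁅y, adCoeff x y n (j + 1)⁆ + ⁅x, adCoeff x y n j⁆

theorem adCoeff_eq_zero {L : Type v} [LieRing L] (x y : L) (n j : ℕ) (h : n < j) :
    adCoeff x y n j = 0 := by
  induction n generalizing j with
  | zero =>
    cases j with
    | zero => omega
    | succ j => rfl
  | succ n ih =>
    cases j with
    | zero => omega
    | succ j => simp [adCoeff, ih (j + 1) (by omega), ih j (by omega)]

open scoped TensorProduct Polynomial in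
theorem ad_pow_eq_sum (F : Type u) {L : Type v} [Field F] [LieRing L] [LieAlgebra F L]
    (x y : L) (n : ℕ) :
    ((LieAlgebra.ad F[X] (F[X] ⊗[F] L) ((Polynomial.X : F[X]) ⊗ₜ[F] x + (1 : F[X]) ⊗ₜ[F] y)) ^ n)
        ((1 : F[X]) ⊗ₜ[F] x) =
      ∑ j ∈ Finset.range (n + 1), ((Polynomial.X : F[X]) ^ j) ⊗ₜ[F] (adCoeff x y n j) := by
  induction n with
  | zero => simp [adCoeff]
  | succ n ih =>
    rw [pow_succ', Module.End.mul_apply, ih, LieAlgebra.ad_apply, lie_sum]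
    simp only [add_lie, LieAlgebra.ExtendScalars.bracket_tmul, Finset.sum_add_distrib, one_mul]
    rw [Finset.sum_range_succ' _ (n + 1)]
    simp only [adCoeff, TensorProduct.tmul_add, Finset.sum_add_distrib, ← pow_succ']
    rw [Finset.sum_range_succ (fun j => ((Polynomial.X : F[X]) ^ (j + 1)) ⊗ₜ[F]
        ⁅y, adCoeff x y n (j + 1)⁆) n, adCoeff_eq_zero x y n (n + 1) (by omega),
      Finset.sum_range_succ' (fun j => ((Polynomial.X : F[X]) ^ j) ⊗ₜ[F] ⁅y, adCoeff x y n j⁆) n]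
    simp only [lie_zero, TensorProduct.tmul_zero, add_zero]
    abel

/-- Jacobson's Lie polynomial `s_i(x, y)`, `1 ≤ i ≤ p - 1`, over a field of characteristic `p`:
`i • s_i(x, y)` is the coefficient of `T ^ (i - 1)` in `(ad (x ⊗ T + y ⊗ 1)) ^ (p - 1) (x ⊗ 1)`. -/
def jacobsonS (p : ℕ) (F : Type u) {L : Type v} [Field F] [LieRing L] [LieAlgebra F L]
    (i : ℕ) (x y : L) : L :=
  (i : F)⁻¹ • adCoeff x y (p - 1) (i - 1)

end RestrictedLie

/-- A restricted Lie algebra (in the sense of Jacobson) over a field `F` of characteristic `p`: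
a Lie algebra with a `p`-map `x ↦ x^[p]`. -/
class RestrictedLieAlgebra (p : ℕ) (F : Type u) (L : Type v) [Field F] [LieRing L]
    [LieAlgebra F L] where
  /-- The `p`-map `x ↦ x^[p]`. -/
  pMap : L → L
  ad_pMap : ∀ x : L, LieAlgebra.ad F L (pMap x) = (LieAlgebra.ad F L x) ^ p
  pMap_smul : ∀ (a : F) (x : L), pMap (a • x) = a ^ p • pMap x
  pMap_add : ∀ x y : L, pMap (x + y) =
    pMap x + pMap y + ∑ i ∈ Finset.Icc 1 (p - 1), RestrictedLie.jacobsonS p F i x y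

namespace RestrictedLie

section

variable (p : ℕ) (F : Type u) (L : Type v) [Field F] [LieRing L] [LieAlgebra F L]
  [RestrictedLieAlgebra p F L]

open RestrictedLieAlgebra (pMap)

/-- The relations `x ^ p = x^[p]`, for `x` in `L`, on the universal enveloping algebra `U(L)`. -/
inductive EnvelopingRel :
    UniversalEnvelopingAlgebra F L → UniversalEnvelopingAlgebra F L → Prop
  | pow_eq (x : L) : EnvelopingRel (UniversalEnvelopingAlgebra.ι F x ^ p)
      (UniversalEnvelopingAlgebra.ι F (pMap p F x))

/-- The restricted enveloping algebra `u(L)`: the quotient of `U(L)` by the two-sided ideal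
generated by the elements `x ^ p - x^[p]`, for `x` in `L`. -/
def RestrictedEnvelopingAlgebra : Type (max u v) := RingQuot (EnvelopingRel p F L)

noncomputable instance : Ring (RestrictedEnvelopingAlgebra p F L) :=
  inferInstanceAs (Ring (RingQuot (EnvelopingRel p F L)))

noncomputable instance : Algebra F (RestrictedEnvelopingAlgebra p F L) :=
  inferInstanceAs (Algebra F (RingQuot (EnvelopingRel p F L)))

variable {L}

/-- A restricted subalgebra is a Lie subalgebra that is closed under the `p`-map. -/
def IsRestrictedSubalgebra (H : LieSubalgebra F L) : Prop :=
  ∀ x ∈ H, pMap p F x ∈ H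

/-- A restricted ideal is a Lie ideal that is closed under the `p`-map. -/
def IsRestrictedIdeal (I : LieIdeal F L) : Prop :=
  ∀ x ∈ I, pMap p F x ∈ I

/-- The restricted subalgebra generated by `S`: the smallest restricted subalgebra
that contains `S`. -/
def restrictedClosure (S : Set L) : LieSubalgebra F L :=
  sInf {H : LieSubalgebra F L | IsRestrictedSubalgebra p F H ∧ S ⊆ H}

/-- An element is `p`-nilpotent if it is killed by some iterate of the `p`-map. -/
def IsPNilpotent (x : L) : Prop :=
  ∃ n : ℕ, (pMap p F)^[n] x = 0

/-- A subset is `p`-nil if each of its elements is `p`-nilpotent. -/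
def IsPNil (S : Set L) : Prop :=
  ∀ x ∈ S, IsPNilpotent p F x

variable (L)

/-- All finitely generated restricted subalgebras are finite-dimensional. -/
def IsLocallyFiniteDimensional : Prop :=
  ∀ S : Set L, S.Finite → FiniteDimensional F (restrictedClosure p F S)

end

/-- A ring `R` is semiperfect if `R / J(R)` is Artinian, where `J(R)` is the Jacobson radical, and
idempotents of `R / J(R)` lift to idempotents of `R`. (Mathlib's `IsArtinianRing` is the left
Artinian condition; for the semiprimitive ring `R / J(R)` it is equivalent to the right one, both
saying that `R / J(R)` is semisimple.) -/
def IsSemiperfectRing (R : Type u) [Ring R] : Prop :=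
  IsArtinianRing (R ⧸ Ring.jacobson R) ∧
    ∀ a : R ⧸ Ring.jacobson R, IsIdempotentElem a →
      ∃ e : R, IsIdempotentElem e ∧ Ideal.Quotient.mk (Ring.jacobson R) e = a

end RestrictedLie

/-! Write `A = u(L)`, `f : L → A` for the canonical map and `I` for the left ideal generated by
`f(P)`. Only three facts about `f` matter: it turns brackets into commutators, `f(x) ^ p` is again
in `f(L)`, and `f(L)` generates `A`. No PBW theorem is needed.

Commuting factors past `f(P)` shows that `I` is two-sided. The quotient `A / I` is generated by the
image of a basis of `L / P`. Reordering a product costs only shorter products, and `p`-th powers of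
generators reduce to linear terms, so finitely many monomials span: `A / I` is finite-dimensional,
hence Artinian.

The ideal `I` is nil. An element `z` of `I` involves finitely many elements of `L`; they lie in a
finite-dimensional subalgebra `H`, and `z ∈ B * V` with `B` generated by `f(H)` and `V = f(P ∩ H)`.
Since `P` is `p`-nil, `V` consists of nilpotent elements, so `V ^ k = 0` by Engel's theorem. As `V *
B ≤ B * V`, also `(B * V) ^ (k + 1) ≤ B * V ^ (k + 1) = 0`.

A nil ideal with Artinian quotient makes the Jacobson radical nil, and idempotents lift modulo a nil
ideal. -/

namespace RestrictedLie

open Submodule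

/-! ### Engel's theorem in associative form -/

section Engel

/-- Engel's theorem for a representation `ρ` of a finite-dimensional Lie algebra by nilpotent
endomorphisms. -/
theorem exists_pow_range_eq_bot {F Q M : Type*} [Field F] [LieRing Q] [LieAlgebra F Q]
    [FiniteDimensional F Q] [AddCommGroup M] [Module F M] (ρ : Q →ₗ[F] Module.End F M)
    (hρ : ∀ x y, ρ ⁅x, y⁆ = ρ x * ρ y - ρ y * ρ x) (hnil : ∀ x, IsNilpotent (ρ x)) :
    ∃ k : ℕ, (LinearMap.range ρ) ^ k = ⊥ := by
  let _ : LieRingModule Q M :=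
    { bracket := fun x m => ρ x m
      add_lie := fun x y m => by simp
      lie_add := fun x m n => by simp
      leibniz_lie := fun x y m => by
        change ρ x (ρ y m) = ρ ⁅x, y⁆ m + ρ y (ρ x m)
        simp [hρ] }
  let _ : LieModule F Q M :=
    { smul_lie := fun t x m => by
        change ρ (t • x) m = t • ρ x m
        simp
      lie_smul := fun t x m => by
        change ρ x (t • m) = t • ρ x m
        simp }
  have hM : LieModule.IsNilpotent Q M := by
    rw [LieModule.isNilpotent_iff_forall (R := F)]
    exact hnil
  obtain ⟨k, hk⟩ := (LieModule.isNilpotent_iff F Q M).mp hM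
  -- Each further factor from the range of `ρ` moves the image one step down the lower central
  -- series.
  have key : ∀ n : ℕ, ∀ f ∈ (LinearMap.range ρ) ^ n, ∀ m : M,
      f m ∈ LieModule.lowerCentralSeries F Q M n := by
    intro n
    induction n with
    | zero => intro f _ m; simp
    | succ n ih =>
      intro f hf
      rw [pow_succ'] at hf
      induction hf using Submodule.mul_induction_on' with
      | mem_mul_mem g hg h hh =>
        obtain ⟨x, rfl⟩ := hg
        intro m
        rw [LieModule.lowerCentralSeries_succ]
        exact LieSubmodule.lie_mem_lie (LieSubmodule.mem_top x) (ih h hh m)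
      | add g _ h _ hg hh => intro m; exact add_mem (hg m) (hh m)
  refine ⟨k, (Submodule.eq_bot_iff _).mpr fun f hf => LinearMap.ext fun m => ?_⟩
  have := key k f hf m
  rw [hk] at this
  simpa using this

/-- The image of a finite-dimensional Lie algebra in an associative algebra is nilpotent as soon
as it consists of nilpotent elements. -/
theorem exists_pow_range_eq_bot_of_isNilpotent {F Q A : Type*} [Field F] [LieRing Q]
    [LieAlgebra F Q] [FiniteDimensional F Q] [Ring A] [Algebra F A] (f : Q →ₗ[F] A)
    (hf : ∀ x y, f ⁅x, y⁆ = f x * f y - f y * f x) (hnil : ∀ x, IsNilpotent (f x)) :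
    ∃ k : ℕ, (LinearMap.range f) ^ k = ⊥ := by
  -- Left multiplication represents `A` faithfully on itself, so vanishing can be tested on
  -- operators.
  obtain ⟨k, hk⟩ := exists_pow_range_eq_bot ((Algebra.lmul F A).toLinearMap ∘ₗ f)
    (fun x y => by
      change Algebra.lmul F A (f ⁅x, y⁆) = _
      rw [hf, map_sub, map_mul, map_mul]
      rfl) (fun x => (hnil x).map (Algebra.lmul F A))
  refine ⟨k, ?_⟩
  rw [LinearMap.range_comp, ← Submodule.map_pow] at hk
  exact Submodule.map_injective_of_injective (f := (Algebra.lmul F A).toLinearMap)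
    Algebra.lmul_injective (hk.trans (Submodule.map_bot _).symm)

end Engel

/-! ### Spanning by bounded monomials -/

section Reduction

variable {F A : Type*} [Field F] [Ring A] [Algebra F A] {m : ℕ} (w : Fin m → A)

/-- The span of the products of at most `n` of the elements `w i`. -/
def monomialSpan (n : ℕ) : Submodule F A :=
  span F ((fun l : List (Fin m) => (l.map w).prod) '' {l | l.length ≤ n})

variable {w}

theorem prod_mem_monomialSpan {n : ℕ} {l : List (Fin m)} (h : l.length ≤ n) :
    (l.map w).prod ∈ monomialSpan (F := F) w n :=
  subset_span ⟨l, h, rfl⟩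

theorem monomialSpan_mono {a b : ℕ} (h : a ≤ b) :
    monomialSpan (F := F) w a ≤ monomialSpan w b :=
  span_mono (Set.image_mono fun _ hl => le_trans hl h)

theorem monomialSpan_mul_le (a b : ℕ) :
    monomialSpan (F := F) w a * monomialSpan w b ≤ monomialSpan w (a + b) := by
  rw [monomialSpan, monomialSpan, span_mul_span, span_le]
  rintro _ ⟨_, ⟨l, hl, rfl⟩, _, ⟨l', hl', rfl⟩, rfl⟩
  refine subset_span ⟨l ++ l', ?_, by simp⟩
  simp only [Set.mem_ofPred_eq, List.length_append] at *
  omega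

theorem monomialSpan_fg (n : ℕ) : (monomialSpan (F := F) w n).FG :=
  fg_span ((List.finite_length_le _ n).image _)

theorem span_range_le_monomialSpan_one : span F (Set.range w) ≤ monomialSpan w 1 := by
  rw [span_le]
  rintro _ ⟨i, rfl⟩
  simpa using prod_mem_monomialSpan (F := F) (w := w) (l := [i]) (n := 1) (by simp)

/-- Permuting the factors of a product changes it by shorter products. -/
theorem prod_sub_prod_mem_of_perm
    (hlie : ∀ i j, w i * w j - w j * w i ∈ span F (Set.range w)) {l l' : List (Fin m)}
    (h : l.Perm l') :
    (l.map w).prod - (l'.map w).prod ∈ monomialSpan (F := F) w (l.length - 1) := by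
  induction h with
  | nil => simp
  | cons i h ih =>
    rename_i l l'
    -- The empty tail is separate: truncated subtraction gives `0 - 1 = 0`, and the length count
    -- below would be off by one.
    rcases Nat.eq_zero_or_pos l.length with h0 | h0
    · obtain rfl := List.length_eq_zero_iff.mp h0
      obtain rfl := List.nil_perm.mp h
      simp
    · have := monomialSpan_mul_le (F := F) (w := w) 1 (l.length - 1)
        (mul_mem_mul (prod_mem_monomialSpan (l := [i]) (by simp)) ih)
      have h1 : 1 + (l.length - 1) = (i :: l).length - 1 := by simp; omega
      rw [h1] at this
      simpa [mul_sub] using this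
  | swap i j l =>
    have := monomialSpan_mul_le (F := F) (w := w) 1 l.length
      (mul_mem_mul (span_range_le_monomialSpan_one (hlie j i))
        (prod_mem_monomialSpan (l := l) le_rfl))
    have h1 : 1 + l.length = (j :: i :: l).length - 1 := by simp; omega
    rw [h1] at this
    simpa [sub_mul, mul_assoc] using this
  | trans h _ ih ih' =>
    rw [← h.length_eq] at ih'
    simpa using add_mem ih ih'

/-- A product of more than `m * (p - 1)` factors is a combination of shorter products. -/
theorem prod_mem_monomialSpan_pred {p : ℕ} (hp : 2 ≤ p)
    (hlie : ∀ i j, w i * w j - w j * w i ∈ span F (Set.range w))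
    (hpow : ∀ i, w i ^ p ∈ span F (Set.range w)) {l : List (Fin m)}
    (hl : m * (p - 1) < l.length) :
    (l.map w).prod ∈ monomialSpan (F := F) w (l.length - 1) := by
  -- Pigeonhole: if each of the `m` letters occurred at most `p - 1` times, the length would be at
  -- most `m * (p - 1)`.
  obtain ⟨i, hi⟩ : ∃ i, p ≤ l.count i := by
    by_contra! hcon
    have h1 : l.length = ∑ i : Fin m, l.count i := by
      have := Multiset.sum_count_eq_card (s := Finset.univ) (m := (l : Multiset (Fin m)))
        (fun a _ => Finset.mem_univ a)
      simpa using this.symm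
    have h2 : ∑ i : Fin m, l.count i ≤ ∑ _i : Fin m, (p - 1) :=
      Finset.sum_le_sum fun i _ => by have := hcon i; omega
    simp only [Finset.sum_const, Finset.card_univ, Fintype.card_fin, smul_eq_mul] at h2
    omega
  obtain ⟨l', hl'⟩ : ∃ l', l.Perm (List.replicate p i ++ l') :=
    by
    obtain ⟨l', hl'⟩ := (List.replicate_sublist_iff.mpr hi).exists_perm_append
    exact ⟨l', hl'⟩
  have hlen : l.length = p + l'.length := by simpa using hl'.length_eq
  have h1 := prod_sub_prod_mem_of_perm (F := F) hlie hl'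
  have h2 := monomialSpan_mul_le (F := F) (w := w) 1 l'.length
    (mul_mem_mul (span_range_le_monomialSpan_one (hpow i))
      (prod_mem_monomialSpan (l := l') le_rfl))
  -- Collapsing `w i ^ p` to a linear term replaces `p` factors by one, a strict drop because `2 ≤
  -- p`.
  have h3 := monomialSpan_mono (F := F) (w := w) (show 1 + l'.length ≤ l.length - 1 by omega) h2
  have h4 := add_mem h1 h3
  simpa using h4

/-- An algebra generated by finitely many elements whose span is closed under commutators and
contains the `p`-th powers of the generators is finite-dimensional. -/
theorem finiteDimensional_of_adjoin_range_eq_top {p : ℕ} (hp : 2 ≤ p)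
    (hlie : ∀ i j, w i * w j - w j * w i ∈ span F (Set.range w))
    (hpow : ∀ i, w i ^ p ∈ span F (Set.range w))
    (hgen : Algebra.adjoin F (Set.range w) = ⊤) : FiniteDimensional F A := by
  set N := m * (p - 1)
  have hstep : ∀ l : List (Fin m), (l.map w).prod ∈ monomialSpan (F := F) w N := by
    have : ∀ n, monomialSpan (F := F) w n ≤ monomialSpan w N := by
      intro n
      induction n with
      | zero => exact monomialSpan_mono (Nat.zero_le _)
      | succ n ih =>
        rw [monomialSpan, span_le]
        rintro _ ⟨l, hl, rfl⟩
        rcases Nat.lt_or_ge N l.length with h | h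
        · refine ih (monomialSpan_mono ?_ (prod_mem_monomialSpan_pred hp hlie hpow h))
          simp only [Set.mem_ofPred_eq] at hl
          omega
        · exact prod_mem_monomialSpan h
    exact fun l => this l.length (prod_mem_monomialSpan le_rfl)
  have htop : (⊤ : Submodule F A) ≤ monomialSpan w N := by
    rw [← Algebra.top_toSubmodule, ← hgen, Algebra.adjoin_eq_span, span_le]
    intro x hx
    obtain ⟨l, hl, rfl⟩ := Submonoid.exists_list_of_mem_closure hx
    obtain ⟨l, rfl⟩ : l ∈ Set.range (List.map w) := by
      rw [Set.range_list_map]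
      exact hl
    exact hstep _
  exact ⟨top_le_iff.mp htop ▸ monomialSpan_fg N⟩

end Reduction

/-! ### Semiperfect rings from nil ideals -/

section Ring

/-- If `R` has a nil ideal with Artinian quotient, then `R` is semiperfect. -/
theorem isSemiperfectRing_of_nil {R : Type*} [Ring R] (I : Ideal R) [I.IsTwoSided]
    (hnil : ∀ x ∈ I, IsNilpotent x) [IsArtinianRing (R ⧸ I)] : IsSemiperfectRing R := by
  have hI : I ≤ Ring.jacobson R := by
    intro x hx
    rw [← Ideal.jacobson_bot, Ideal.mem_jacobson_iff]
    intro y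
    have hn : IsNilpotent (y * x) := hnil _ (I.mul_mem_left y hx)
    obtain ⟨u, hu⟩ := hn.isUnit_one_add
    refine ⟨(↑u⁻¹ : R), ?_⟩
    have := u.inv_mul
    rw [hu, mul_add, mul_one] at this
    rw [Ideal.mem_bot, mul_assoc, add_comm, this, sub_self]
  -- The radical maps into that of the Artinian ring `R ⧸ I`, which is nilpotent; so a power of `x`
  -- falls into the nil ideal `I`.
  have hJ : ∀ x ∈ Ring.jacobson R, IsNilpotent x := by
    intro x hx
    have h1 : Ideal.Quotient.mk I x ∈ Ring.jacobson (R ⧸ I) := by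
      have := Ring.le_comap_jacobson (Ideal.Quotient.mk I) hx
      exact this
    obtain ⟨n, hn⟩ := IsArtinianRing.isNilpotent_jacobson_bot (R := R ⧸ I)
    rw [Ideal.jacobson_bot] at hn
    have h2 := Ideal.pow_mem_pow h1 n
    rw [hn, Ideal.zero_eq_bot, Ideal.mem_bot, ← map_pow, Ideal.Quotient.eq_zero_iff_mem] at h2
    obtain ⟨k, hk⟩ := hnil _ h2
    exact ⟨n * k, by rw [pow_mul, hk]⟩
  refine ⟨?_, fun a ha => ?_⟩
  · exact (Ideal.Quotient.factor_surjective hI).isArtinianRing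
  · refine exists_isIdempotentElem_eq_of_ker_isNilpotent (Ideal.Quotient.mk (Ring.jacobson R))
      ?_ a (Ideal.Quotient.mk_surjective a) ha
    intro x hx
    rw [Ideal.mk_ker] at hx
    exact hJ x hx

end Ring

/-! ### Ideals generated by a Lie ideal -/

section Ideal

variable {F L A : Type*} [Field F] [LieRing L] [LieAlgebra F L] [Ring A] [Algebra F A]
  (f : L →ₗ[F] A)

/-- From `f v * f y = f y * f v + f ⁅v, y⁆`, a factor from `V` passes to the right of each
generator, up to a term of `f(V)`. It serves both the two-sidedness of the ideal (`H = ⊤`) and its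
nilness (`H` finite-dimensional). -/
theorem map_mul_adjoin_le (hf : ∀ x y, f ⁅x, y⁆ = f x * f y - f y * f x) {H V : Submodule F L}
    (hV : ∀ x ∈ V, ∀ y ∈ H, ⁅x, y⁆ ∈ V) :
    V.map f * (Algebra.adjoin F (f '' H)).toSubmodule ≤
      (Algebra.adjoin F (f '' H)).toSubmodule * V.map f := by
  set B := Algebra.adjoin F (f '' (H : Set L))
  have hBB : ∀ b ∈ B, ∀ z ∈ B.toSubmodule * V.map f, b * z ∈ B.toSubmodule * V.map f := by
    intro b hb z hz
    have := mul_mem_mul (show b ∈ B.toSubmodule from hb) hz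
    rwa [← mul_assoc, (Subalgebra.isIdempotentElem_toSubmodule B).eq] at this
  suffices h : ∀ b ∈ B, ∀ v ∈ V, f v * b ∈ B.toSubmodule * V.map f by
    rw [Submodule.mul_le]
    rintro _ ⟨v, hv, rfl⟩ b hb
    exact h b hb v hv
  intro b hb
  induction hb using Algebra.adjoin_induction with
  | mem b hb =>
    obtain ⟨y, hy, rfl⟩ := hb
    intro v hv
    have h1 : f v * f y = f y * f v + 1 * f ⁅v, y⁆ := by rw [hf, one_mul, add_sub_cancel]
    rw [h1]
    exact add_mem (mul_mem_mul (Algebra.subset_adjoin ⟨y, hy, rfl⟩) ⟨v, hv, rfl⟩)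
      (mul_mem_mul (one_mem B) ⟨_, hV v hv y hy, rfl⟩)
  | algebraMap r =>
    intro v hv
    rw [← Algebra.commutes]
    exact mul_mem_mul (algebraMap_mem B r) ⟨v, hv, rfl⟩
  | add a b _ _ ha hb =>
    intro v hv
    rw [mul_add]
    exact add_mem (ha v hv) (hb v hv)
  | mul a b ha hb iha ihb =>
    intro v hv
    have h1 := iha v hv
    rw [← mul_assoc]
    generalize f v * a = z at h1
    induction h1 using Submodule.mul_induction_on' with
    | mem_mul_mem c hc d hd =>
      obtain ⟨u, hu, rfl⟩ := hd
      rw [mul_assoc]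
      exact hBB c hc _ (ihb u hu)
    | add c _ d _ hc hd => rw [add_mul]; exact add_mem hc hd

/-- All copies of `B` are gathered on the left. The exponent starts at `1`: in degree `0` the claim
would require `1 ∈ B`, which is not assumed. -/
theorem mul_pow_le_of_mul_le {B V : Submodule F A} (hB : B * B = B) (h : V * B ≤ B * V) (n : ℕ) :
    (B * V) ^ (n + 1) ≤ B * V ^ (n + 1) := by
  have hn : ∀ n : ℕ, V ^ n * B ≤ B * V ^ n := by
    intro n
    induction n with
    | zero => simp
    | succ n ih =>
      calc V ^ (n + 1) * B = V ^ n * (V * B) := by rw [pow_succ, mul_assoc]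
        _ ≤ V ^ n * (B * V) := mul_le_mul' le_rfl h
        _ = V ^ n * B * V := by rw [mul_assoc]
        _ ≤ B * V ^ n * V := mul_le_mul' ih le_rfl
        _ = B * V ^ (n + 1) := by rw [mul_assoc, pow_succ]
  induction n with
  | zero => simp
  | succ n ih =>
    calc (B * V) ^ (n + 2) = (B * V) ^ (n + 1) * (B * V) := pow_succ _ _
      _ ≤ B * V ^ (n + 1) * (B * V) := mul_le_mul' ih le_rfl
      _ = B * (V ^ (n + 1) * B) * V := by simp only [mul_assoc]
      _ ≤ B * (B * V ^ (n + 1)) * V := mul_le_mul' (mul_le_mul' le_rfl (hn _)) le_rfl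
      _ = B * V ^ (n + 2) := by rw [← mul_assoc, hB, mul_assoc, ← pow_succ]

/-- If `V` is a Lie ideal of a finite-dimensional subalgebra `H` that acts by nilpotent elements,
then every element of the left ideal generated by `V` in the algebra generated by `H` is
nilpotent. -/
theorem isNilpotent_of_mem_adjoin_mul (hf : ∀ x y, f ⁅x, y⁆ = f x * f y - f y * f x)
    (H : LieSubalgebra F L) [FiniteDimensional F H] (P : LieIdeal F L)
    (hnil : ∀ x ∈ P, IsNilpotent (f x)) {z : A}
    (hz : z ∈ (Algebra.adjoin F (f '' H)).toSubmodule *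
      (P.toSubmodule ⊓ H.toSubmodule).map f) : IsNilpotent z := by
  set Q : LieIdeal F H := P.comap H.incl
  let g : Q →ₗ[F] A := f ∘ₗ (H.incl : H →ₗ[F] L) ∘ₗ (Q.incl : Q →ₗ[F] H)
  obtain ⟨k, hk⟩ := exists_pow_range_eq_bot_of_isNilpotent g
    (fun x y => hf _ _) (fun x => hnil _ x.2)
  have hrange : LinearMap.range g =
      (P.toSubmodule ⊓ H.toSubmodule).map f := by
    rw [LinearMap.range_comp]
    congr 1
    ext x
    constructor
    · rintro ⟨y, rfl⟩
      exact ⟨y.2, y.1.2⟩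
    · rintro ⟨h1, h2⟩
      exact ⟨⟨⟨x, h2⟩, h1⟩, rfl⟩
  rw [hrange] at hk
  have hle := map_mul_adjoin_le f hf (H := H.toSubmodule)
    (V := P.toSubmodule ⊓ H.toSubmodule)
    (fun x hx y hy => ⟨lie_mem_left F L P x y hx.1, H.lie_mem hx.2 hy⟩)
  have h1 := mul_pow_le_of_mul_le (Subalgebra.isIdempotentElem_toSubmodule _) hle k
    (Submodule.pow_mem_pow _ hz (k + 1))
  rw [pow_succ, hk] at h1
  exact ⟨k + 1, by simpa using h1⟩

/-- The left ideal generated by the image of a Lie ideal is two-sided. -/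
theorem isTwoSided_span_image (hf : ∀ x y, f ⁅x, y⁆ = f x * f y - f y * f x)
    (hgen : Algebra.adjoin F (Set.range f) = ⊤) (P : LieIdeal F L) :
    (Ideal.span (f '' P)).IsTwoSided := by
  -- As an `F`-subspace the left ideal is `A * f(P)`; two-sidedness then follows from `f(P) * A ≤ A
  -- * f(P)`.
  have hmul : (⊤ : Submodule F A) * P.toSubmodule.map f =
      (Ideal.span (f '' P)).restrictScalars F := by
    apply le_antisymm
    · rw [Submodule.mul_le]
      rintro a - _ ⟨x, hx, rfl⟩
      exact Ideal.mul_mem_left _ a (Ideal.subset_span ⟨x, hx, rfl⟩)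
    · intro z hz
      change z ∈ Ideal.span (f '' P) at hz
      induction hz using Submodule.span_induction with
      | mem z hz =>
        obtain ⟨x, hx, rfl⟩ := hz
        rw [← one_mul (f x)]
        exact mul_mem_mul mem_top ⟨x, hx, rfl⟩
      | zero => exact zero_mem _
      | add a b _ _ ha hb => exact add_mem ha hb
      | smul a z _ hz =>
        have := mul_mem_mul (show a ∈ (⊤ : Submodule F A) from mem_top) hz
        rw [← mul_assoc] at this
        exact (mul_le_mul' le_top le_rfl : _ ≤ ⊤ * P.toSubmodule.map f) this
  have hle := map_mul_adjoin_le f hf (H := ⊤) (V := P.toSubmodule)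
    (fun x hx y _ => lie_mem_left F L P x y hx)
  rw [Submodule.top_coe, Set.image_univ, hgen, Algebra.top_toSubmodule, hmul] at hle
  constructor
  intro z b hz
  change z * b ∈ (Ideal.span (f '' P)).restrictScalars F
  have hz' : z ∈ (Ideal.span (f '' P)).restrictScalars F := hz
  rw [← hmul] at hz'
  have h2 := mul_mem_mul hz' (show b ∈ (⊤ : Submodule F A) from mem_top)
  rw [mul_assoc] at h2
  have h3 := mul_le_mul' (le_refl (⊤ : Submodule F A)) hle h2
  rw [← hmul, ← mul_assoc] at h3
  rw [← hmul]
  exact (mul_le_mul' le_top le_rfl : _ ≤ ⊤ * P.toSubmodule.map f) h3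

end Ideal

/-! ### Local descriptions and the finite-dimensional quotient -/

section Assembly

variable {F L A : Type*} [Field F] [LieRing L] [LieAlgebra F L] [Ring A] [Algebra F A]
  (f : L →ₗ[F] A)

theorem exists_finite_mem_adjoin_image (hgen : Algebra.adjoin F (Set.range f) = ⊤) (a : A) :
    ∃ S : Set L, S.Finite ∧ a ∈ Algebra.adjoin F (f '' S) := by
  have ha : a ∈ Algebra.adjoin F (Set.range f) := hgen ▸ Algebra.mem_top
  induction ha using Algebra.adjoin_induction with
  | mem a ha =>
    obtain ⟨x, rfl⟩ := ha
    exact ⟨{x}, Set.finite_singleton x, Algebra.subset_adjoin ⟨x, rfl, rfl⟩⟩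
  | algebraMap r => exact ⟨∅, Set.finite_empty, Subalgebra.algebraMap_mem _ r⟩
  | add a b _ _ ha hb =>
    obtain ⟨S, hS, ha⟩ := ha
    obtain ⟨T, hT, hb⟩ := hb
    exact ⟨S ∪ T, hS.union hT, add_mem
      (Algebra.adjoin_mono (Set.image_mono Set.subset_union_left) ha)
      (Algebra.adjoin_mono (Set.image_mono Set.subset_union_right) hb)⟩
  | mul a b _ _ ha hb =>
    obtain ⟨S, hS, ha⟩ := ha
    obtain ⟨T, hT, hb⟩ := hb
    exact ⟨S ∪ T, hS.union hT, mul_mem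
      (Algebra.adjoin_mono (Set.image_mono Set.subset_union_left) ha)
      (Algebra.adjoin_mono (Set.image_mono Set.subset_union_right) hb)⟩

/-- One finite `S` serves every `H` containing it, so `H` can later be taken to be the restricted
closure of `S`. -/
theorem exists_finite_mem_adjoin_mul (hgen : Algebra.adjoin F (Set.range f) = ⊤)
    (P : LieIdeal F L) {z : A} (hz : z ∈ Ideal.span (f '' P)) :
    ∃ S : Set L, S.Finite ∧ ∀ H : LieSubalgebra F L, S ⊆ H →
      z ∈ (Algebra.adjoin F (f '' H)).toSubmodule *
        (P.toSubmodule ⊓ H.toSubmodule).map f := by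
  induction hz using Submodule.span_induction with
  | mem z hz =>
    obtain ⟨x, hx, rfl⟩ := hz
    refine ⟨{x}, Set.finite_singleton x, fun H hH => ?_⟩
    rw [← one_mul (f x)]
    exact mul_mem_mul (one_mem (Algebra.adjoin F (f '' H))) ⟨x, ⟨hx, hH rfl⟩, rfl⟩
  | zero => exact ⟨∅, Set.finite_empty, fun _ _ => zero_mem _⟩
  | add a b _ _ ha hb =>
    obtain ⟨S, hS, ha⟩ := ha
    obtain ⟨T, hT, hb⟩ := hb
    exact ⟨S ∪ T, hS.union hT, fun H hH => add_mem
      (ha H (Set.subset_union_left.trans hH)) (hb H (Set.subset_union_right.trans hH))⟩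
  | smul a z _ hz =>
    obtain ⟨S, hS, hz⟩ := hz
    obtain ⟨T, hT, ha⟩ := exists_finite_mem_adjoin_image f hgen a
    refine ⟨S ∪ T, hS.union hT, fun H hH => ?_⟩
    have h1 : a ∈ (Algebra.adjoin F (f '' H)).toSubmodule :=
      Algebra.adjoin_mono (Set.image_mono (Set.subset_union_right.trans hH)) ha
    have h2 := mul_mem_mul h1 (hz H (Set.subset_union_left.trans hH))
    rwa [← mul_assoc, (Subalgebra.isIdempotentElem_toSubmodule _).eq] at h2

/-- The quotient by the ideal generated by a Lie ideal `P` of finite codimension is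
finite-dimensional when the image of `L` is closed under `p`-th powers. -/
theorem finiteDimensional_quotient_span_image {p : ℕ} (hp : 2 ≤ p)
    (hf : ∀ x y, f ⁅x, y⁆ = f x * f y - f y * f x)
    (hpow : ∀ x, f x ^ p ∈ LinearMap.range f)
    (hgen : Algebra.adjoin F (Set.range f) = ⊤) (P : LieIdeal F L)
    [FiniteDimensional F (L ⧸ P)] [(Ideal.span (f '' P)).IsTwoSided] :
    FiniteDimensional F (A ⧸ Ideal.span (f '' P)) := by
  set I := Ideal.span (f '' P)
  let π : A →ₐ[F] A ⧸ I := Ideal.Quotient.mkₐ F I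
  have hπ : Function.Surjective π := Ideal.Quotient.mkₐ_surjective F I
  -- Since `f(P)` dies in `A ⧸ I`, a finite basis of `L ⧸ P` already spans the image of `L` there.
  let g : (L ⧸ P.toSubmodule) →ₗ[F] A ⧸ I := P.toSubmodule.liftQ (π.toLinearMap ∘ₗ f)
    (fun x hx => Ideal.Quotient.eq_zero_iff_mem.mpr (Ideal.subset_span ⟨x, hx, rfl⟩))
  have : FiniteDimensional F (L ⧸ P.toSubmodule) := ‹FiniteDimensional F (L ⧸ P)›
  let b := Module.finBasis F (L ⧸ P.toSubmodule)
  have hspan : span F (Set.range (g ∘ b)) = LinearMap.range (π.toLinearMap ∘ₗ f) := by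
    rw [Set.range_comp, ← Submodule.map_span, b.span_eq, Submodule.map_top]
    exact range_liftQ _ _ _
  have hmem : ∀ i, ∃ x, π (f x) = (g ∘ b) i := fun i => by
    have : (g ∘ b) i ∈ span F (Set.range (g ∘ b)) := subset_span ⟨i, rfl⟩
    rw [hspan] at this
    exact this
  refine finiteDimensional_of_adjoin_range_eq_top (w := g ∘ b) hp ?_ ?_ ?_
  · intro i j
    obtain ⟨x, hx⟩ := hmem i
    obtain ⟨y, hy⟩ := hmem j
    rw [hspan, ← hx, ← hy, ← map_mul π, ← map_mul π, ← map_sub, ← hf]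
    exact ⟨_, rfl⟩
  · intro i
    obtain ⟨x, hx⟩ := hmem i
    obtain ⟨y, hy⟩ := hpow x
    rw [hspan, ← hx, ← map_pow, ← hy]
    exact ⟨_, rfl⟩
  · rw [← Algebra.adjoin_span, hspan, eq_top_iff, ← (AlgHom.range_eq_top π).mpr hπ,
      ← Algebra.map_top, ← hgen, AlgHom.map_adjoin]
    refine Algebra.adjoin_mono ?_
    rintro _ ⟨_, ⟨x, rfl⟩, rfl⟩
    exact ⟨x, rfl⟩

end Assembly

/-! ### The restricted enveloping algebra -/

section Enveloping

variable (p : ℕ) (F : Type u) (L : Type v) [Field F] [LieRing L] [LieAlgebra F L]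
  [RestrictedLieAlgebra p F L]

open RestrictedLieAlgebra (pMap)

attribute [local instance] LieRing.ofAssociativeRing

/-- The quotient map from the universal to the restricted enveloping algebra. -/
noncomputable def RestrictedEnvelopingAlgebra.mk :
    UniversalEnvelopingAlgebra F L →ₐ[F] RestrictedEnvelopingAlgebra p F L :=
  RingQuot.mkAlgHom F (EnvelopingRel p F L)

/-- The canonical map from `L` to `u(L)`. -/
noncomputable def RestrictedEnvelopingAlgebra.ι : L →ₗ[F] RestrictedEnvelopingAlgebra p F L :=
  (RestrictedEnvelopingAlgebra.mk p F L).toLinearMap ∘ₗ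
    (UniversalEnvelopingAlgebra.ι F : L →ₗ⁅F⁆ UniversalEnvelopingAlgebra F L)

namespace RestrictedEnvelopingAlgebra

variable {L}

theorem ι_lie (x y : L) : ι p F L ⁅x, y⁆ = ι p F L x * ι p F L y - ι p F L y * ι p F L x := by
  change mk p F L (UniversalEnvelopingAlgebra.ι F ⁅x, y⁆) = _
  rw [LieHom.map_lie, LieRing.of_associative_ring_bracket, map_sub, map_mul, map_mul]
  rfl

theorem ι_pow (x : L) : ι p F L x ^ p = ι p F L (pMap p F x) := by
  change mk p F L (UniversalEnvelopingAlgebra.ι F x) ^ p = _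
  rw [← map_pow]
  exact RingQuot.mkAlgHom_rel F (EnvelopingRel.pow_eq x)

theorem ι_pow_pow (x : L) (n : ℕ) : ι p F L x ^ p ^ n = ι p F L ((pMap p F)^[n] x) := by
  induction n generalizing x with
  | zero => simp
  | succ n ih => rw [pow_succ', pow_mul, ι_pow, ih, Function.iterate_succ_apply]

theorem isNilpotent_ι {x : L} (hx : IsPNilpotent p F x) : IsNilpotent (ι p F L x) := by
  obtain ⟨n, hn⟩ := hx
  exact ⟨p ^ n, by rw [ι_pow_pow, hn, map_zero]⟩

variable (L)

theorem adjoin_range_ι : Algebra.adjoin F (Set.range (ι p F L)) = ⊤ := by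
  let φ : TensorAlgebra F L →ₐ[F] RestrictedEnvelopingAlgebra p F L :=
    (mk p F L).comp (UniversalEnvelopingAlgebra.mkAlgHom F L)
  have h1 : Function.Surjective (UniversalEnvelopingAlgebra.mkAlgHom F L) :=
    RingCon.mkₐ_surjective _
  have h2 : Function.Surjective (mk p F L) := RingQuot.mkAlgHom_surjective F _
  have hφ : Function.Surjective φ := by
    rw [AlgHom.coe_comp]
    exact h2.comp h1
  rw [← (AlgHom.range_eq_top φ).mpr hφ, ← Algebra.map_top, ← TensorAlgebra.adjoin_range_ι,
    AlgHom.map_adjoin, ← Set.range_comp]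
  rfl

variable {p F L}

/-- The restricted enveloping algebra of a locally finite-dimensional restricted Lie algebra is
semiperfect as soon as there is a `p`-nil ideal of finite codimension. -/
theorem isSemiperfectRing [Fact p.Prime] (hL : IsLocallyFiniteDimensional p F L) (P : LieIdeal F L)
    (hnil : IsPNil p F (P : Set L)) [FiniteDimensional F (L ⧸ P)] :
    IsSemiperfectRing (RestrictedEnvelopingAlgebra p F L) := by
  have htwo := isTwoSided_span_image (ι p F L) (ι_lie p F) (adjoin_range_ι p F L) P
  have hquot := finiteDimensional_quotient_span_image (ι p F L) (Fact.out : p.Prime).two_le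
    (ι_lie p F) (fun x => ⟨_, (ι_pow p F x).symm⟩) (adjoin_range_ι p F L) P
  have hart : IsArtinianRing (RestrictedEnvelopingAlgebra p F L ⧸ Ideal.span (ι p F L '' P)) :=
    IsArtinianRing.of_finite F _
  refine isSemiperfectRing_of_nil (Ideal.span (ι p F L '' P)) fun z hz => ?_
  obtain ⟨S, hS, hmem⟩ := exists_finite_mem_adjoin_mul (ι p F L) (adjoin_range_ι p F L) P hz
  -- Local finiteness makes the restricted closure of `S` finite-dimensional, as Engel's theorem
  -- requires.
  have := hL S hS
  exact isNilpotent_of_mem_adjoin_mul (ι p F L) (ι_lie p F) (restrictedClosure p F S) P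
    (fun x hx => isNilpotent_ι p F (hnil x hx))
    (hmem _ fun x hx => by
      rw [restrictedClosure, LieSubalgebra.coe_sInf]
      exact Set.mem_iInter₂.mpr fun H hH => hH.2 hx)

end RestrictedEnvelopingAlgebra

end Enveloping

end RestrictedLie

theorem theorem2p6 {p : ℕ} [Fact p.Prime] {F : Type u} [Field F] [CharP F p]
    {L : Type v} [LieRing L] [LieAlgebra F L] [RestrictedLieAlgebra p F L]
    (hL : RestrictedLie.IsLocallyFiniteDimensional p F L)
    (hP : ∃ P : LieIdeal F L, RestrictedLie.IsRestrictedIdeal p F P ∧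
      RestrictedLie.IsPNil p F (P : Set L) ∧ FiniteDimensional F (L ⧸ P)) :
    RestrictedLie.IsSemiperfectRing (RestrictedLie.RestrictedEnvelopingAlgebra p F L) := by
  obtain ⟨P, -, hnil, _⟩ := hP
  exact RestrictedLie.RestrictedEnvelopingAlgebra.isSemiperfectRing hL P hnil
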